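/- **Setting.** Let $\mathcal P$ be a finite set of labelled prototiles: compact subsets of $\mathbb R^2$, each the closure of its interior, with boundary divided into finitely many arcs (its sides) meeting only at endpoints, and with puncture $x(p)=0$ in its interior. A tile is a translate $t=p+x$, with puncture $x(t)=x$. Let $\omega$ be a primitive substitution rule on $\mathcal P$ with scaling factor $\lambda>1$, normalised so that $p\in\omega(p)$: the tiles of the patch $\omega(p)$ have disjoint interiors and cover $\lambda p$ (whose interior is connected), and $\omega(p+x)=\omega(p)+\lambda x$. Put $D_{pq}=\{x: q+x\in\omega(p)\}$, $T_p=\bigcup_n\omega^n(p)$, and $\mathcal R(B)_p=\bigcup_q\lambda^{-1}(B_q+D_{pq})$ for families $B=(B_p)_{p\in\mathcal P}$ of subsets of the plane. The root of the patch $\omega^n(q)+x$ is the tile $q+x$; thus the root of $\omega(t)$, for $t=q+x$, is $q+\lambda x$. A *consistent quasi-dual tree* in $\mathcal P$ is a family $G=(G_p)_{p\in\mathcal P}$ of finite geometric trees $G_p\subset p$ (edges are arcs meeting only at common endpoints), such that the puncture is an interior vertex of $G_p$, $G_p$ meets $\partial p$ in exactly one vertex in the interior of each side of $p$ (and nowhere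 else), and whenever two sides of tiles coincide in some $T_q$, the corresponding boundary vertices coincide. (Dual trees, where every edge has the puncture as an endpoint, are included.) Let $(G,S)$ be a *recurrent pair*: two such trees with a homeomorphism $\psi:G\to S$ of graphs (preserving prototiles, punctures and the sides belonging to boundary vertices) such that $S\subset\mathcal R(G)$, each edge $\psi(e)$ of $S$ being a union of edges of $\mathcal R(G)$. For edges $e$ of $G_p$ and $f$ of $G_q$ let $$D^E_{ef}=\{x\in D_{pq}:\lambda^{-1}(f+x)\subseteq\psi(e)\},\qquad M^E_{ef}=|D^E_{ef}| .$$ Assume that $M^E$ is primitive, with Perron–Frobenius eigenvalue $\kappa$ and a positive eigenvector $v$, $M^Ev=\kappa v$. Let $A$ be the *fractal graph* of $(G,S)$: its edges $A_e$ form the attractor given by $A_e=\bigcup_f\lambda^{-1}(A_f+D^E_{ef})$, and it is assumed that with these edges $A$ is a consistent quasi-dual tree of the same combinatorial type as $G$. Translates of $A_e$ have length $\ell(A_e)=v_e$. Let $F_1$ be a subgraph of $\mathcal R(A)$ such that, for every $q\in\mathcal P$, $(F_1)_q$ is a connected tree contained in the interior of $q$, has the punctures of all subtiles $\lambda^{-1}t$,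 $t\in\omega(q)$, among its vertices, and contains every edge $\lambda^{-1}(A_f+x)\subset A_q$, $x\in D^E_{ef}$ with $e$ an edge of $G_q$, neither endpoint of which is a boundary vertex of $A_q$. Let $F_{n+1}=\mathcal R(F_n)\cup F_n$ for $n\ge1$. For $p\in\mathcal P$ put $\mathfrak F_p=\bigcup_{n\ge1}\lambda^n(F_n)_p$; it is called a *fractal tree* on $T_p$ if it is a connected tree, i.e. any two of its distinct points are joined by exactly one arc in it. For tiles $t,t'\in T_p$ the *fractal distance* $d_{\mathfrak F_p}(t,t')$ is the sum of the lengths of the edges $A_e+x$ (with $e$ an edge of $G_q$ and $q+x\in T_p$) that make up the unique path in $\mathfrak F_p$ between the punctures $x(t)$ and $x(t')$ (it is $0$ if $t=t'$). **Lemma.** Fix $p\in\mathcal P$ and let $\mathfrak F_p$ be a fractal tree on $T_p$. Let $t,t'\in T_p$, and let $r$ and $r'$ be the roots of $\omega(t)$ and $\omega(t')$. Then $$d_{\mathfrak F_p}(r,r')=\kappa\, d_{\mathfrak F_p}(t,t').$$ -/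

import Mathlib

open scoped Pointwise

namespace FractalTiling

/-- The Euclidean plane. -/
abbrev Plane : Type := EuclideanSpace ℝ (Fin 2)

/-- `γ` is an arc from `a` to `b`: the image of an injective continuous map on `[0,1]`. In
particular `a ≠ b`. -/
def IsArc (γ : Set Plane) (a b : Plane) : Prop :=
  ∃ f : unitInterval → Plane,
    Continuous f ∧ Function.Injective f ∧ f 0 = a ∧ f 1 = b ∧ Set.range f = γ

/-- A connected tree in the plane: any two distinct points of `X` are the endpoints of exactly one
arc contained in `X`. -/
def IsTree (X : Set Plane) : Prop :=
  X.Nonempty ∧ ∀ a ∈ X, ∀ b ∈ X, a ≠ b → ∃! γ : Set Plane, γ ⊆ X ∧ IsArc γ a b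

/-! ### Prototiles, tiles and substitution rules -/

/-- A finite set of prototiles. The elements of `P` are the labels, so that distinct prototiles may
have the same support. The puncture of every prototile is the origin. The boundary of a prototile
is divided into finitely many arcs, its sides (the "edges" of the tile); `Side` lists the sides of
all the prototiles, and `side s` is an arc from `sideLeft s` to `sideRight s`. -/
structure PrototileSet (P Side : Type*) where
  supp : P → Set Plane
  isCompact_supp : ∀ p, IsCompact (supp p)
  closure_interior_supp : ∀ p, closure (interior (supp p)) = supp p
  puncture_mem : ∀ p, (0 : Plane) ∈ interior (supp p)
  sideHome : Side → P
  side : Side → Set Plane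
  sideLeft : Side → Plane
  sideRight : Side → Plane
  isArc_side : ∀ s, IsArc (side s) (sideLeft s) (sideRight s)
  iUnion_side : ∀ p, ⋃ (s : Side) (_ : sideHome s = p), side s = frontier (supp p)
  side_inter : ∀ s s', sideHome s = sideHome s' → s ≠ s' →
    side s ∩ side s' ⊆ {sideLeft s, sideRight s} ∩ {sideLeft s', sideRight s'}

/-- The tile `(p, x)` is the translate `p + x` of the prototile `p`, carrying the label of `p`.
As the punctures of the prototiles are at the origin, its puncture is `x`. -/
abbrev Tile (P : Type*) : Type _ := P × Plane

/-- The puncture `x(t)` of a tile. -/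
def puncture {P : Type*} (t : Tile P) : Plane := t.2

variable {P Side V Ed : Type*}

/-- The support of a tile. -/
def PrototileSet.tileSupp (Pr : PrototileSet P Side) (t : Tile P) : Set Plane :=
  t.2 +ᵥ Pr.supp t.1

/-- A substitution rule `ω` with scaling factor `λ > 1`, normalised so that `p ∈ ω(p)`. -/
structure Substitution (Pr : PrototileSet P Side) where
  scale : ℝ
  one_lt_scale : 1 < scale
  rule : P → Finset (Tile P)
  cover : ∀ p, ⋃ t ∈ rule p, Pr.tileSupp t = scale • Pr.supp p
  disjoint : ∀ p, ∀ t ∈ rule p, ∀ t' ∈ rule p, t ≠ t' →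
    Disjoint (interior (Pr.tileSupp t)) (interior (Pr.tileSupp t'))
  patch_connected : ∀ p, IsConnected (interior (⋃ t ∈ rule p, Pr.tileSupp t))
  self_mem : ∀ p, (p, (0 : Plane)) ∈ rule p

namespace Substitution

variable {Pr : PrototileSet P Side} (σ : Substitution Pr)

/-- The substitution matrix: `M p q` is the number of translates of `q` in `ω(p)`. -/
noncomputable def matrix : Matrix P P ℝ :=
  fun p q => ({x : Plane | (q, x) ∈ σ.rule p}.ncard : ℝ)

/-- The substitution rule is primitive. -/
def IsPrimitive [Fintype P] [DecidableEq P] : Prop := σ.matrix.IsPrimitive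

/-- `ω` applied to a collection of tiles, where `ω(q + x) = ω(q) + λ x`. -/
def subst (Q : Set (Tile P)) : Set (Tile P) :=
  {u | ∃ t ∈ Q, ∃ s ∈ σ.rule t.1, u = (s.1, s.2 + σ.scale • t.2)}

/-- The patch `ω^n(p)`. -/
def patch (n : ℕ) (p : P) : Set (Tile P) := σ.subst^[n] {(p, 0)}

/-- The tiling `T_p = ⋃ n, ω^n(p)` generated by `p`. -/
def tiling (p : P) : Set (Tile P) := ⋃ n, σ.patch n p

/-- The supertile of order `n` with root `r = q + x`, that is, the patch `ω^n(q) + x`. -/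
def supertile (n : ℕ) (r : Tile P) : Set (Tile P) :=
  {u | ∃ s ∈ σ.patch n r.1, u = (s.1, s.2 + r.2)}

/-- The root of `ω(t)`: for `t = q + x` we have `ω(t) = ω(q) + λ x`, whose root is `q + λ x`. -/
def root (t : Tile P) : Tile P := (t.1, σ.scale • t.2)

/-- `ω(t)` is the supertile of order `1` whose root is `root t`. -/
theorem subst_singleton (t : Tile P) : σ.subst {t} = σ.supertile 1 (σ.root t) := by
  ext u
  simp [subst, supertile, patch, root]

/-- The contraction map `ℛ(B)_p = ⋃ q, λ⁻¹ (B_q + D_{pq})`, where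
`D_{pq} = {x | q + x ∈ ω(p)}`. -/
def contraction (B : P → Set Plane) (p : P) : Set Plane :=
  ⋃ t ∈ σ.rule p, σ.scale⁻¹ • (t.2 +ᵥ B t.1)

end Substitution

/-! ### Quasi-dual trees -/

/-- The combinatorial type of a family of graphs, one in every prototile: vertices, edges with
their two endpoints (in the same prototile), the vertex to be placed at the puncture of a prototile,
and the boundary vertex belonging to every side. Graphs of the same type are identified through
their types, so that the homeomorphism between two of them sends the edge labelled `e` to the edge
labelled `e`. -/
structure GraphType (Pr : PrototileSet P Side) (V Ed : Type*) where
  vertexHome : V → P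
  home : Ed → P
  src : Ed → V
  tgt : Ed → V
  src_home : ∀ e, vertexHome (src e) = home e
  tgt_home : ∀ e, vertexHome (tgt e) = home e
  center : P → V
  center_home : ∀ p, vertexHome (center p) = p
  bdry : Side → V
  bdry_home : ∀ s, vertexHome (bdry s) = Pr.sideHome s

/-- A drawing in the plane of the vertices and the edges of a graph type. -/
structure Drawing (V Ed : Type*) where
  pos : V → Plane
  arc : Ed → Set Plane

/-- The part in the prototile `p` of a drawing, as a subset of the plane. -/
def Drawing.carrier {Pr : PrototileSet P Side} (D : Drawing V Ed) (Γ : GraphType Pr V Ed) (p : P) :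
    Set Plane :=
  ⋃ (e : Ed) (_ : Γ.home e = p), D.arc e

/-- `D` is a family of quasi-dual trees, one in each prototile: a geometric graph which is a
connected tree, is inscribed in the prototile, has the puncture as an interior vertex, and meets
the boundary of the prototile exactly in the boundary vertices, one in the interior of each side.
(Dual trees are those in which every edge has the puncture as an endpoint.) -/
structure IsQuasiDualTree {Pr : PrototileSet P Side} (Γ : GraphType Pr V Ed) (D : Drawing V Ed) :
    Prop where
  isArc : ∀ e, IsArc (D.arc e) (D.pos (Γ.src e)) (D.pos (Γ.tgt e))
  pos_injective : ∀ v w, Γ.vertexHome v = Γ.vertexHome w → D.pos v = D.pos w → v = w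
  exists_edge : ∀ v, ∃ e, v = Γ.src e ∨ v = Γ.tgt e
  nonoverlapping : ∀ e f, Γ.home e = Γ.home f → e ≠ f →
    D.arc e ∩ D.arc f ⊆
      {D.pos (Γ.src e), D.pos (Γ.tgt e)} ∩ {D.pos (Γ.src f), D.pos (Γ.tgt f)}
  isTree : ∀ p, IsTree (D.carrier Γ p)
  subset_supp : ∀ p, D.carrier Γ p ⊆ Pr.supp p
  pos_center : ∀ p, D.pos (Γ.center p) = 0
  pos_bdry : ∀ s, D.pos (Γ.bdry s) ∈ Pr.side s \ {Pr.sideLeft s, Pr.sideRight s}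
  inter_frontier : ∀ p, D.carrier Γ p ∩ frontier (Pr.supp p) =
    {z | ∃ s, Pr.sideHome s = p ∧ z = D.pos (Γ.bdry s)}

/-- Consistency: whenever two sides of tiles meet in one of the tilings `T_q`, the associated
boundary vertices meet. -/
def IsConsistent {Pr : PrototileSet P Side} (σ : Substitution Pr) (Γ : GraphType Pr V Ed)
    (D : Drawing V Ed) : Prop :=
  ∀ (q : P) (s s' : Side) (x x' : Plane),
    (Pr.sideHome s, x) ∈ σ.tiling q → (Pr.sideHome s', x') ∈ σ.tiling q →
    x +ᵥ Pr.side s = x' +ᵥ Pr.side s' → x + D.pos (Γ.bdry s) = x' + D.pos (Γ.bdry s')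

/-- The edge digit set `D^E_{ef} = {x ∈ D_{pq} | λ⁻¹ (f + x) ⊆ ψ(e)}`, for an edge `e` of `G_p`
and an edge `f` of `G_q`, where `ψ : G → S` is the homeomorphism, `ψ(e) = S.arc e`. -/
def edgeDigits {Pr : PrototileSet P Side} (σ : Substitution Pr) (Γ : GraphType Pr V Ed)
    (G S : Drawing V Ed) (e f : Ed) : Set Plane :=
  {x | (Γ.home f, x) ∈ σ.rule (Γ.home e) ∧ σ.scale⁻¹ • (x +ᵥ G.arc f) ⊆ S.arc e}

/-- The edge substitution matrix `M^E`. -/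
noncomputable def edgeMatrix {Pr : PrototileSet P Side} (σ : Substitution Pr)
    (Γ : GraphType Pr V Ed) (G S : Drawing V Ed) : Matrix Ed Ed ℝ :=
  fun e f => ((edgeDigits σ Γ G S e f).ncard : ℝ)

/-- A recurrent pair `(G, S)`: homeomorphic consistent quasi-dual trees with `S ⊆ ℛ(G)`, every edge
of `S` being composed of edges of `ℛ(G)`. -/
structure IsRecurrentPair {Pr : PrototileSet P Side} (σ : Substitution Pr) (Γ : GraphType Pr V Ed)
    (G S : Drawing V Ed) : Prop where
  quasiDual_left : IsQuasiDualTree Γ G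
  quasiDual_right : IsQuasiDualTree Γ S
  consistent_left : IsConsistent σ Γ G
  consistent_right : IsConsistent σ Γ S
  composed : ∀ e, S.arc e =
    ⋃ (f : Ed), ⋃ x ∈ edgeDigits σ Γ G S e f, σ.scale⁻¹ • (x +ᵥ G.arc f)

/-- `A` is the fractal graph of the recurrent pair `(G, S)`: a consistent quasi-dual tree whose
edges form the attractor of the graph iterated function system given by the edge digits. -/
structure IsFractalGraph {Pr : PrototileSet P Side} (σ : Substitution Pr) (Γ : GraphType Pr V Ed)
    (G S A : Drawing V Ed) : Prop where
  quasiDual : IsQuasiDualTree Γ A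
  consistent : IsConsistent σ Γ A
  attractor : ∀ e, A.arc e =
    ⋃ (f : Ed), ⋃ x ∈ edgeDigits σ Γ G S e f, σ.scale⁻¹ • (x +ᵥ A.arc f)

/-- `κ` and `v` are the Perron-Frobenius eigenvalue and a Perron-Frobenius eigenvector of the
(primitive) matrix `M`: `M v = κ v` with all entries of `v` positive. -/
def IsPerronFrobenius [Fintype Ed] (M : Matrix Ed Ed ℝ) (κ : ℝ) (v : Ed → ℝ) : Prop :=
  (∀ e, 0 < v e) ∧ M.mulVec v = κ • v

/-! ### Fractal trees -/

/-- The subset of the plane covered by the edges `λ⁻¹ (A_f + x)`, `(f, x) ∈ E₁ p`, of `ℛ(A)_p`. -/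
def seedCarrier {Pr : PrototileSet P Side} (σ : Substitution Pr) (A : Drawing V Ed)
    (E₁ : P → Set (Ed × Plane)) (p : P) : Set Plane :=
  ⋃ i ∈ E₁ p, σ.scale⁻¹ • (i.2 +ᵥ A.arc i.1)

/-- The conditions on the first graph `F_1`, a subgraph of `ℛ(A)` with set of edges `E₁`:
each `(F_1)_p` is a connected tree, the punctures of all subtiles are among its vertices, it lies in
the interior of `p`, and it contains `A°_p`, the graph `A_p` (subdivided into edges of `ℛ(A)_p`)
without those edges that have a boundary vertex of `A_p` as an endpoint. -/
structure IsSeed {Pr : PrototileSet P Side} (σ : Substitution Pr) (Γ : GraphType Pr V Ed)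
    (G S A : Drawing V Ed) (E₁ : P → Set (Ed × Plane)) : Prop where
  subgraph : ∀ p, ∀ i ∈ E₁ p, (Γ.home i.1, i.2) ∈ σ.rule p
  isTree : ∀ p, IsTree (seedCarrier σ A E₁ p)
  puncture_mem : ∀ p, ∀ t ∈ σ.rule p, ∃ i ∈ E₁ p,
    σ.scale⁻¹ • puncture t = σ.scale⁻¹ • (i.2 + A.pos (Γ.src i.1)) ∨
    σ.scale⁻¹ • puncture t = σ.scale⁻¹ • (i.2 + A.pos (Γ.tgt i.1))
  subset_interior : ∀ p, seedCarrier σ A E₁ p ⊆ interior (Pr.supp p)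
  reduced_subgraph : ∀ (e f : Ed), ∀ x ∈ edgeDigits σ Γ G S e f,
    (∀ s, Pr.sideHome s = Γ.home e →
      σ.scale⁻¹ • (x + A.pos (Γ.src f)) ≠ A.pos (Γ.bdry s) ∧
      σ.scale⁻¹ • (x + A.pos (Γ.tgt f)) ≠ A.pos (Γ.bdry s)) →
    (f, x) ∈ E₁ (Γ.home e)

/-- The graphs `F_n`, with `F_{n+1} = ℛ(F_n) ∪ F_n`. The index is shifted: `F₁` is `F_1` and
`stage σ F₁ n` is `F_{n+1}`. -/
def stage {Pr : PrototileSet P Side} (σ : Substitution Pr) (F₁ : P → Set Plane) :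
    ℕ → P → Set Plane
  | 0 => F₁
  | n + 1 => fun p => σ.contraction (stage σ F₁ n) p ∪ stage σ F₁ n p

/-- The graph `𝔉_p = ⋃ n ≥ 1, λ^n (F_n)_p`. -/
def fractalTree {Pr : PrototileSet P Side} (σ : Substitution Pr) (A : Drawing V Ed)
    (E₁ : P → Set (Ed × Plane)) (p : P) : Set Plane :=
  ⋃ n : ℕ, σ.scale ^ (n + 1) • stage σ (seedCarrier σ A E₁) n p

/-- `fractalTree σ A E₁ p` is a fractal tree on `T_p`: it is built from admissible `F_1`, and it is
a connected tree. (It always contains the punctures of the tiles of `T_p`.) -/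
def IsFractalTree {Pr : PrototileSet P Side} (σ : Substitution Pr) (Γ : GraphType Pr V Ed)
    (G S A : Drawing V Ed) (E₁ : P → Set (Ed × Plane)) (p : P) : Prop :=
  IsSeed σ Γ G S A E₁ ∧ IsTree (fractalTree σ A E₁ p)

/-- The path in the tree `X` between the points `a` and `b`: the arc in `X` from `a` to `b`. (If
`X` is a tree and `a ≠ b` are in `X` there is exactly one, which is therefore equal to this union;
for `a = b` the path has no edges, and the union is empty.) -/
def treePath (X : Set Plane) (a b : Plane) : Set Plane :=
  ⋃₀ {γ | γ ⊆ X ∧ IsArc γ a b}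

/-- The fractal distance between two tiles of `T_p`: the sum of the lengths `v e` of the fractal
edges `A_e + x`, with `A_e + x` in a tile of `T_p`, that make up the path in `𝔉_p` between the
punctures. -/
noncomputable def fractalDist {Pr : PrototileSet P Side} (σ : Substitution Pr)
    (Γ : GraphType Pr V Ed) (A : Drawing V Ed) (v : Ed → ℝ) (E₁ : P → Set (Ed × Plane)) (p : P)
    (t t' : Tile P) : ℝ :=
  ∑ᶠ i ∈ {i : Ed × Plane | (Γ.home i.1, i.2) ∈ σ.tiling p ∧
      i.2 +ᵥ A.arc i.1 ⊆ treePath (fractalTree σ A E₁ p) (puncture t) (puncture t')},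
    v i.1

end FractalTiling

open FractalTiling

namespace FractalTiling

variable {P Side V Ed : Type*}

/-! ### Arcs -/

/-! Inflation by `λ` carries the path between two punctures to the path between the punctures of the
roots, and multiplies its length by `κ`. The first half is formal. Since `F_n ⊆ F_{n+1}`, the
fractal tree satisfies `λ𝔉 ⊆ 𝔉` (`smul_fractalTree_subset`). Hence if `γ` is the arc in `𝔉` from
`x(t)` to `x(t')`, then `λγ` is an arc in `𝔉` from `λx(t)` to `λx(t')`, and in a tree there is only
one. For the second half, the attractor equation cuts each inflated edge `λ(A_e + x)` into the edges
indexed by its `subdivision`, whose lengths add up to `κ v_e` because `M^E v = κ v`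
(`sum_subdivision`). It remains to see that the edges in `λγ` are exactly the disjoint union of the
subdivisions of the edges in `γ` (`edges_smul_arc`, `disjoint_subdivision`). The geometric input is
that distinct edges of the tiling meet only in end points (`edge_inter_edge`), so that an arc
between punctures which enters the inside of an edge traverses all of it (`edge_subset_arc`). -/

theorem IsArc.isCompact {γ : Set Plane} {a b : Plane} (h : IsArc γ a b) : IsCompact γ := by
  obtain ⟨f, hf, -, -, -, rfl⟩ := h
  exact isCompact_range hf

theorem IsArc.left_mem {γ : Set Plane} {a b : Plane} (h : IsArc γ a b) : a ∈ γ := by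
  obtain ⟨f, -, -, rfl, -, rfl⟩ := h
  exact ⟨0, rfl⟩

theorem IsArc.right_mem {γ : Set Plane} {a b : Plane} (h : IsArc γ a b) : b ∈ γ := by
  obtain ⟨f, -, -, -, rfl, rfl⟩ := h
  exact ⟨1, rfl⟩

theorem IsArc.ne {γ : Set Plane} {a b : Plane} (h : IsArc γ a b) : a ≠ b := by
  obtain ⟨f, -, hi, rfl, rfl, -⟩ := h
  exact fun h => zero_ne_one (hi h)

theorem IsArc.infinite {γ : Set Plane} {a b : Plane} (h : IsArc γ a b) : γ.Infinite := by
  obtain ⟨f, -, hi, -, -, rfl⟩ := h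
  have : Infinite unitInterval := (Set.Icc_infinite (zero_lt_one' ℝ)).to_subtype
  exact Set.infinite_range_of_injective hi

theorem IsArc.image {γ : Set Plane} {a b : Plane} (h : IsArc γ a b) {g : Plane → Plane}
    (hg : Continuous g) (hg' : Function.Injective g) : IsArc (g '' γ) (g a) (g b) := by
  obtain ⟨f, hf, hi, rfl, rfl, rfl⟩ := h
  exact ⟨g ∘ f, hg.comp hf, hg'.comp hi, rfl, rfl, Set.range_comp g f⟩

theorem IsArc.vadd {γ : Set Plane} {a b : Plane} (h : IsArc γ a b) (x : Plane) :
    IsArc (x +ᵥ γ) (x + a) (x + b) :=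
  h.image (g := fun y => x + y) (by fun_prop) (add_right_injective x)

theorem IsArc.smul {γ : Set Plane} {a b : Plane} (h : IsArc γ a b) {c : ℝ} (hc : c ≠ 0) :
    IsArc (c • γ) (c • a) (c • b) :=
  h.image (g := fun y => c • y) (by fun_prop) (smul_right_injective _ hc)

/-- A connected subset of `range h ∪ K` that contains an interior point of the subarc of the arc
`h` between two parameters, and misses the end points of this subarc, is contained in `range h`
minus its end points. -/
theorem mem_open_arc_of_isPreconnected {h : unitInterval → Plane} (hc : Continuous h)
    (hi : Function.Injective h) {K C : Set Plane} (hK : IsClosed K)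
    (hEK : Set.range h ∩ K ⊆ {h 0, h 1}) (hC : IsPreconnected C) (hCE : C ⊆ Set.range h ∪ K)
    {u s w : unitInterval} (hus : u < s) (hsw : s < w) (hs : h s ∈ C) (hu : h u ∉ C)
    (hw : h w ∉ C) {a : Plane} (ha : a ∈ C) : a ∈ Set.range h ∧ a ≠ h 0 ∧ a ≠ h 1 := by
  -- Otherwise `C` meets both closed sets `h[u,w]` and `h[0,u] ∪ h[w,1] ∪ K`. They cover `C`, and
  -- within `C` they are disjoint because `h u` and `h w` are missing.
  have key : a ∈ h '' Set.Ioo u w := by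
    by_contra hna
    have h1 : IsClosed (h '' Set.Icc u w) := (isCompact_Icc.image hc).isClosed
    have h2 : IsClosed (h '' Set.Iic u ∪ h '' Set.Ici w ∪ K) :=
      (((isClosed_Iic.isCompact.image hc).isClosed).union
        ((isClosed_Ici.isCompact.image hc).isClosed)).union hK
    have haK : a ∈ h '' Set.Iic u ∪ h '' Set.Ici w ∪ K := by
      rcases hCE ha with ⟨r, rfl⟩ | haK
      · rcases le_or_gt r u with hr | hr
        · exact .inl (.inl ⟨r, hr, rfl⟩)
        · rcases le_or_gt w r with hr' | hr'
          · exact .inl (.inr ⟨r, hr', rfl⟩)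
          · exact absurd ⟨r, ⟨hr, hr'⟩, rfl⟩ hna
      · exact .inr haK
    obtain ⟨z, hzC, ⟨r, ⟨hur, hrw⟩, rfl⟩, hz⟩ := isPreconnected_closed_iff.1 hC _ _ h1 h2
      (fun z hz => by
        rcases hCE hz with ⟨r, rfl⟩ | hzK
        · rcases le_or_gt r u with hr | hr
          · exact .inr (.inl (.inl ⟨r, hr, rfl⟩))
          · rcases le_or_gt w r with hr' | hr'
            · exact .inr (.inl (.inr ⟨r, hr', rfl⟩))
            · exact .inl ⟨r, ⟨hr.le, hr'.le⟩, rfl⟩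
        · exact .inr (.inr hzK))
      ⟨h s, hs, s, ⟨hus.le, hsw.le⟩, rfl⟩ ⟨a, ha, haK⟩
    have hru : r ≠ u := fun e => hu (e ▸ hzC)
    have hrw' : r ≠ w := fun e => hw (e ▸ hzC)
    rcases hz with (⟨r', hr', e⟩ | ⟨r', hr', e⟩) | hz
    · rw [hi e] at hr'
      exact hru (le_antisymm hr' hur)
    · rw [hi e] at hr'
      exact hrw' (le_antisymm hrw hr')
    · rcases hEK ⟨⟨r, rfl⟩, hz⟩ with e | e
      · have := hi e
        exact hru (le_antisymm (this ▸ unitInterval.nonneg') hur)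
      · have := hi (Set.mem_singleton_iff.1 e)
        exact hrw' (le_antisymm hrw (this ▸ unitInterval.le_one'))
  obtain ⟨r, ⟨h1, h2⟩, rfl⟩ := key
  refine ⟨⟨r, rfl⟩, fun e => ?_, fun e => ?_⟩
  · exact absurd (hi e ▸ h1) (not_lt.2 unitInterval.nonneg')
  · exact absurd (hi e ▸ h2) (not_lt.2 unitInterval.le_one')

/-- An arc in `E ∪ K`, where `E` is an arc meeting the closed set `K` only in end points, contains
all of `E` if it contains an interior point of `E` and its end points are not interior points
of `E`. -/
theorem IsArc.subset_of_mem {E K γ : Set Plane} {c d a b z : Plane} (hE : IsArc E c d)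
    (hK : IsClosed K) (hEK : E ∩ K ⊆ {c, d}) (hγ : IsArc γ a b) (hγE : γ ⊆ E ∪ K)
    (ha : a ∈ E → a = c ∨ a = d) (hb : b ∈ E → b = c ∨ b = d)
    (hz : z ∈ E) (hzc : z ≠ c) (hzd : z ≠ d) (hzγ : z ∈ γ) : E ⊆ γ := by
  obtain ⟨h, hc, hi, rfl, rfl, rfl⟩ := hE
  obtain ⟨f, hf, hfi, rfl, rfl, rfl⟩ := hγ
  obtain ⟨s, rfl⟩ := hz
  obtain ⟨τ, hτ⟩ := hzγ
  rintro _ ⟨r, rfl⟩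
  by_contra hr
  have hs0 : 0 < s := lt_of_le_of_ne unitInterval.nonneg' fun e => hzc (e ▸ rfl)
  have hs1 : s < 1 := lt_of_le_of_ne unitInterval.le_one' fun e => hzd (e ▸ rfl)
  have hrs : r ≠ s := fun e => hr (e ▸ ⟨τ, hτ⟩)
  have hpre (I : Set unitInterval) (hI : I.OrdConnected) : IsPreconnected (f '' I) :=
    hI.isPreconnected.image f hf.continuousOn
  have hsub (I : Set unitInterval) : f '' I ⊆ Set.range h ∪ K :=
    (Set.image_subset_range f I).trans hγE
  have hrI (I : Set unitInterval) : h r ∉ f '' I := fun h => hr (Set.image_subset_range f I h)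
  have hboth {q : unitInterval} (h1 : h q ∈ f '' Set.Iic τ) (h2 : h q ∈ f '' Set.Ici τ) :
      q = s := by
    obtain ⟨x, hx, ex⟩ := h1
    obtain ⟨y, hy, ey⟩ := h2
    have hxy : x = y := hfi (ex.trans ey.symm)
    subst hxy
    have : x = τ := le_antisymm hx hy
    subst this
    exact hi (ex.symm.trans hτ)
  have hmem0 : (0 : unitInterval) ∈ Set.Iic τ := unitInterval.nonneg'
  have hmem1 : (1 : unitInterval) ∈ Set.Ici τ := unitInterval.le_one'
  have notend0 : ¬ (f 0 ∈ Set.range h ∧ f 0 ≠ h 0 ∧ f 0 ≠ h 1) := fun ⟨h1, h2, h3⟩ =>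
    (ha h1).elim h2 h3
  have notend1 : ¬ (f 1 ∈ Set.range h ∧ f 1 ≠ h 0 ∧ f 1 ≠ h 1) := fun ⟨h1, h2, h3⟩ =>
    (hb h1).elim h2 h3
  rcases lt_or_gt_of_ne hrs with hlt | hlt
  -- The point `h r` is missed by `γ`. If one of the halves of `γ` before and after `h s` also
  -- missed `h 1`, it would be trapped inside `E`, although it contains an end point of `γ`. So both
  -- halves pass through `h 1`, which injectivity allows only at their common point `h s`. The other
  -- case is the same with `h 0`.
  · refine hs1.ne' (hboth ?_ ?_)
    · by_contra hn
      exact notend0 (mem_open_arc_of_isPreconnected hc hi hK hEK (hpre _ Set.ordConnected_Iic)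
        (hsub _) hlt hs1 ⟨τ, Set.self_mem_Iic, hτ⟩ (hrI _) hn ⟨0, hmem0, rfl⟩)
    · by_contra hn
      exact notend1 (mem_open_arc_of_isPreconnected hc hi hK hEK (hpre _ Set.ordConnected_Ici)
        (hsub _) hlt hs1 ⟨τ, Set.self_mem_Ici, hτ⟩ (hrI _) hn ⟨1, hmem1, rfl⟩)
  · refine hs0.ne (hboth ?_ ?_)
    · by_contra hn
      exact notend0 (mem_open_arc_of_isPreconnected hc hi hK hEK (hpre _ Set.ordConnected_Iic)
        (hsub _) hs0 hlt ⟨τ, Set.self_mem_Iic, hτ⟩ hn (hrI _) ⟨0, hmem0, rfl⟩)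
    · by_contra hn
      exact notend1 (mem_open_arc_of_isPreconnected hc hi hK hEK (hpre _ Set.ordConnected_Ici)
        (hsub _) hs0 hlt ⟨τ, Set.self_mem_Ici, hτ⟩ hn (hrI _) ⟨1, hmem1, rfl⟩)

/-- In a tree, the path between two distinct points is the unique arc joining them. -/
theorem treePath_eq {X γ : Set Plane} {a b : Plane} (hX : IsTree X) (hγX : γ ⊆ X)
    (hγ : IsArc γ a b) : treePath X a b = γ := by
  refine Set.Subset.antisymm (Set.sUnion_subset fun δ hδ => ?_) fun z hz => ⟨γ, ⟨hγX, hγ⟩, hz⟩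
  have hu := hX.2 a (hγX hγ.left_mem) b (hγX hγ.right_mem) hγ.ne
  exact (hu.unique hδ ⟨hγX, hγ⟩).subset

theorem treePath_self (X : Set Plane) (a : Plane) : treePath X a a = ∅ :=
  Set.sUnion_eq_empty.2 fun _ hδ => absurd rfl hδ.2.ne

/-! ### Tilings generated by a substitution -/

theorem PrototileSet.interior_tileSupp (Pr : PrototileSet P Side) (t : Tile P) :
    interior (Pr.tileSupp t) = t.2 +ᵥ interior (Pr.supp t.1) :=
  interior_vadd _ _

theorem PrototileSet.closure_interior_tileSupp (Pr : PrototileSet P Side) (t : Tile P) :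
    closure (interior (Pr.tileSupp t)) = Pr.tileSupp t := by
  rw [Pr.interior_tileSupp, closure_vadd, Pr.closure_interior_supp]
  rfl

theorem PrototileSet.puncture_mem_interior (Pr : PrototileSet P Side) (t : Tile P) :
    puncture t ∈ interior (Pr.tileSupp t) := by
  rw [Pr.interior_tileSupp]
  exact ⟨0, Pr.puncture_mem _, by simp [puncture]⟩

theorem PrototileSet.disjoint_tileSupp (Pr : PrototileSet P Side) {t : Tile P} {U : Set Plane}
    (hU : IsOpen U) (h : Disjoint U (interior (Pr.tileSupp t))) : Disjoint U (Pr.tileSupp t) := by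
  rw [← Pr.closure_interior_tileSupp]
  exact h.closure_right hU

namespace Substitution

variable {Pr : PrototileSet P Side} (σ : Substitution Pr)

theorem scale_pos : 0 < σ.scale := zero_lt_one.trans σ.one_lt_scale

theorem scale_ne_zero : σ.scale ≠ 0 := σ.scale_pos.ne'

theorem mem_patch_zero {p : P} {u : Tile P} : u ∈ σ.patch 0 p ↔ u = (p, 0) := Iff.rfl

theorem patch_succ (n : ℕ) (p : P) : σ.patch (n + 1) p = σ.subst (σ.patch n p) :=
  Function.iterate_succ_apply' _ _ _

theorem subst_mono {Q Q' : Set (Tile P)} (h : Q ⊆ Q') : σ.subst Q ⊆ σ.subst Q' :=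
  fun _ ⟨t, ht, s, hs, e⟩ => ⟨t, h ht, s, hs, e⟩

/-- The normalisation `p ∈ ω(p)` starts the induction; it is what makes the patches nested. -/
theorem patch_subset_succ (n : ℕ) (p : P) : σ.patch n p ⊆ σ.patch (n + 1) p := by
  induction n with
  | zero =>
    rintro _ rfl
    rw [patch_succ]
    exact ⟨(p, 0), rfl, (p, 0), σ.self_mem p, by simp⟩
  | succ n ih =>
    rw [patch_succ, patch_succ _ (n + 1)]
    exact σ.subst_mono ih

theorem patch_mono (p : P) : Monotone fun n => σ.patch n p :=
  monotone_nat_of_le_succ fun n => σ.patch_subset_succ n p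

theorem patch_subset_tiling (n : ℕ) (p : P) : σ.patch n p ⊆ σ.tiling p :=
  Set.subset_iUnion (fun n => σ.patch n p) n

theorem mem_tiling {p : P} {u : Tile P} : u ∈ σ.tiling p ↔ ∃ n, u ∈ σ.patch n p :=
  Set.mem_iUnion

/-- Peels off the first substitution instead of the last, to match the recursion `F_{n+1} = ℛ(F_n) ∪
F_n`, in which `ℛ` acts at the coarsest level. -/
theorem mem_patch_succ_iff {n : ℕ} {p : P} {u : Tile P} : u ∈ σ.patch (n + 1) p ↔
    ∃ t ∈ σ.rule p, ∃ s ∈ σ.patch n t.1, u = (s.1, s.2 + σ.scale ^ n • t.2) := by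
  induction n generalizing u with
  | zero =>
    rw [patch_succ]
    constructor
    · rintro ⟨_, rfl, s, hs, rfl⟩
      exact ⟨s, hs, (s.1, 0), rfl, by simp⟩
    · rintro ⟨t, ht, _, rfl, rfl⟩
      exact ⟨(p, 0), rfl, t, ht, by simp⟩
  | succ n ih =>
    rw [patch_succ]
    constructor
    · rintro ⟨w, hw, s, hs, rfl⟩
      obtain ⟨t, ht, s', hs', rfl⟩ := ih.1 hw
      refine ⟨t, ht, (s.1, s.2 + σ.scale • s'.2), ?_, ?_⟩
      · rw [patch_succ]
        exact ⟨s', hs', s, hs, rfl⟩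
      · simp only [smul_add, smul_smul, pow_succ', add_assoc]
    · rintro ⟨t, ht, w, hw, rfl⟩
      rw [patch_succ] at hw
      obtain ⟨s', hs', s, hs, rfl⟩ := hw
      refine ⟨(s'.1, s'.2 + σ.scale ^ n • t.2), ih.2 ⟨t, ht, s', hs', rfl⟩, s, hs, ?_⟩
      simp only [smul_add, smul_smul, pow_succ', add_assoc]

theorem tileSupp_subst_subset {t s : Tile P} (hs : s ∈ σ.rule t.1) :
    Pr.tileSupp (s.1, s.2 + σ.scale • t.2) ⊆ σ.scale • Pr.tileSupp t := by
  rintro _ ⟨z, hz, rfl⟩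
  have h : s.2 +ᵥ z ∈ σ.scale • Pr.supp t.1 := by
    rw [← σ.cover]
    exact Set.mem_biUnion hs ⟨z, hz, rfl⟩
  obtain ⟨w, hw, e⟩ := h
  refine ⟨t.2 +ᵥ w, ⟨w, hw, rfl⟩, ?_⟩
  simp only [vadd_eq_add, smul_add] at e ⊢
  rw [e]
  abel

/-- Tiles with the same parent are separated by the substitution rule, tiles with different parents
by the inflated supports of the parents. -/
theorem disjoint_patch (n : ℕ) {p : P} {t t' : Tile P} (ht : t ∈ σ.patch n p)
    (ht' : t' ∈ σ.patch n p) (hne : t ≠ t') :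
    Disjoint (interior (Pr.tileSupp t)) (interior (Pr.tileSupp t')) := by
  induction n generalizing t t' with
  | zero => exact absurd (ht.trans ht'.symm) hne
  | succ n ih =>
    rw [patch_succ] at ht ht'
    obtain ⟨t, ht, s, hs, rfl⟩ := ht
    obtain ⟨t', ht', s', hs', rfl⟩ := ht'
    by_cases h : t = t'
    · subst h
      have hss : s ≠ s' := fun e => hne (e ▸ rfl)
      have := σ.disjoint _ s hs s' hs' hss
      have key (s : Tile P) : interior (Pr.tileSupp (s.1, s.2 + σ.scale • t.2)) =
          (σ.scale • t.2) +ᵥ interior (Pr.tileSupp s) := by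
        rw [Pr.interior_tileSupp, Pr.interior_tileSupp, vadd_vadd, add_comm]
      rw [key, key]
      exact (Set.disjoint_image_iff (add_right_injective (σ.scale • t.2))).2 this
    · have := ih ht ht' h
      refine Disjoint.mono (interior_mono (σ.tileSupp_subst_subset hs))
        (interior_mono (σ.tileSupp_subst_subset hs')) ?_
      rw [interior_smul₀ σ.scale_ne_zero, interior_smul₀ σ.scale_ne_zero]
      exact (Set.disjoint_image_iff (smul_right_injective Plane σ.scale_ne_zero)).2 this

theorem disjoint_tiling {p : P} {t t' : Tile P} (ht : t ∈ σ.tiling p) (ht' : t' ∈ σ.tiling p)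
    (hne : t ≠ t') : Disjoint (interior (Pr.tileSupp t)) (interior (Pr.tileSupp t')) := by
  obtain ⟨n, hn⟩ := σ.mem_tiling.1 ht
  obtain ⟨m, hm⟩ := σ.mem_tiling.1 ht'
  exact σ.disjoint_patch (max n m) (σ.patch_mono p (le_max_left n m) hn)
    (σ.patch_mono p (le_max_right n m) hm) hne

theorem disjoint_interior_tileSupp {p : P} {t t' : Tile P} (ht : t ∈ σ.tiling p)
    (ht' : t' ∈ σ.tiling p) (hne : t ≠ t') :
    Disjoint (interior (Pr.tileSupp t)) (Pr.tileSupp t') :=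
  Pr.disjoint_tileSupp isOpen_interior (σ.disjoint_tiling ht ht' hne)

theorem inter_tileSupp_subset_frontier {p : P} {t t' : Tile P} (ht : t ∈ σ.tiling p)
    (ht' : t' ∈ σ.tiling p) (hne : t ≠ t') :
    Pr.tileSupp t ∩ Pr.tileSupp t' ⊆ frontier (Pr.tileSupp t) := fun _ hz =>
  ⟨subset_closure hz.1, fun h =>
    Set.disjoint_left.1 (σ.disjoint_interior_tileSupp ht ht' hne) h hz.2⟩

theorem iUnion_patch (n : ℕ) (p : P) :
    ⋃ t ∈ σ.patch n p, Pr.tileSupp t = σ.scale ^ n • Pr.supp p := by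
  induction n with
  | zero =>
    ext z
    simp [mem_patch_zero, PrototileSet.tileSupp]
  | succ n ih =>
    rw [pow_succ', mul_smul, ← ih, patch_succ]
    ext z
    simp only [Set.mem_iUnion, exists_prop]
    constructor
    · rintro ⟨_, ⟨t, ht, s, hs, rfl⟩, hz⟩
      obtain ⟨w, hw, rfl⟩ := σ.tileSupp_subst_subset hs hz
      exact ⟨w, by simpa using ⟨t.1, t.2, ht, hw⟩, rfl⟩
    · rintro ⟨w, hw, rfl⟩
      simp only [Set.mem_iUnion, exists_prop] at hw
      obtain ⟨t, ht, y, hy, rfl⟩ := hw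
      have : σ.scale • y ∈ σ.scale • Pr.supp t.1 := ⟨y, hy, rfl⟩
      rw [← σ.cover] at this
      simp only [Set.mem_iUnion, exists_prop] at this
      obtain ⟨s, hs, a, ha, e⟩ := this
      refine ⟨_, ⟨t, ht, s, hs, rfl⟩, a, ha, ?_⟩
      simp only [vadd_eq_add, smul_add] at e ⊢
      rw [← e]
      abel

/-- A tile outside `ω^n(p)` has interior disjoint from the region `λ^n p` which that patch fills,
hence the tile itself misses the interior of the region. Together with exhaustion by patches this
gives local finiteness of the tiling. -/
theorem mem_patch_of_meets {n : ℕ} {p : P} {u : Tile P} (hu : u ∈ σ.tiling p)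
    (h : (interior (σ.scale ^ n • Pr.supp p) ∩ Pr.tileSupp u).Nonempty) : u ∈ σ.patch n p := by
  by_contra hn
  have hdis : Disjoint (interior (Pr.tileSupp u)) (σ.scale ^ n • Pr.supp p) := by
    rw [← σ.iUnion_patch, Set.disjoint_iUnion₂_right]
    exact fun t ht => σ.disjoint_interior_tileSupp hu (σ.patch_subset_tiling n p ht)
      fun e => hn (e ▸ ht)
  exact Set.not_disjoint_iff_nonempty_inter.2 h
    (Pr.disjoint_tileSupp isOpen_interior (hdis.mono_right interior_subset).symm)

theorem finite_patch (n : ℕ) (p : P) : (σ.patch n p).Finite := by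
  induction n with
  | zero => exact Set.finite_singleton _
  | succ n ih =>
    rw [patch_succ]
    refine (ih.biUnion fun t _ => ((σ.rule t.1).finite_toSet.image
      fun s : Tile P => (s.1, s.2 + σ.scale • t.2))).subset ?_
    rintro _ ⟨t, ht, s, hs, rfl⟩
    exact Set.mem_biUnion ht ⟨s, hs, rfl⟩

/-- The supports of the patches `ω^n(p)` exhaust the plane. -/
theorem exists_subset_interior_patch (p : P) {K : Set Plane} (hK : IsCompact K) :
    ∃ n : ℕ, K ⊆ interior (σ.scale ^ n • Pr.supp p) := by
  obtain ⟨ε, hε, hball⟩ := Metric.isOpen_iff.1 isOpen_interior _ (Pr.puncture_mem p)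
  obtain ⟨R, hR⟩ := hK.isBounded.subset_ball 0
  -- The interior of `p` contains the `ε`-ball about the puncture, so it suffices that `λ^n ε > R`.
  obtain ⟨n, hn⟩ := pow_unbounded_of_one_lt (R / ε) σ.one_lt_scale
  refine ⟨n, fun z hz => ?_⟩
  have hpos : 0 < σ.scale ^ n := pow_pos σ.scale_pos n
  rw [interior_smul₀ hpos.ne', Set.mem_smul_set_iff_inv_smul_mem₀ hpos.ne']
  apply hball
  have hz' : ‖z‖ < R := by simpa using hR hz
  rw [mem_ball_zero_iff, norm_smul, norm_inv, Real.norm_of_nonneg hpos.le, inv_mul_lt_iff₀ hpos]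
  exact hz'.trans ((div_lt_iff₀ hε).1 hn)

end Substitution

/-! ### Edges in the tiles of a tiling -/

/-- The edge `A_e + x` of a translated tile. -/
def Drawing.edge (D : Drawing V Ed) (i : Ed × Plane) : Set Plane := i.2 +ᵥ D.arc i.1

section Edges

variable {Pr : PrototileSet P Side} {σ : Substitution Pr} {Γ : GraphType Pr V Ed}
  {G S A : Drawing V Ed} {v : Ed → ℝ} {κ : ℝ} {E₁ : P → Set (Ed × Plane)} {p : P}

/-- The tile to which a translated edge belongs. -/
def GraphType.tile (Γ : GraphType Pr V Ed) (i : Ed × Plane) : Tile P := (Γ.home i.1, i.2)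

/-- The set of the two end points of the translated edge `A_e + x`. -/
def Drawing.ends (D : Drawing V Ed) (Γ : GraphType Pr V Ed) (i : Ed × Plane) : Set Plane :=
  {i.2 + D.pos (Γ.src i.1), i.2 + D.pos (Γ.tgt i.1)}

theorem Drawing.finite_ends (D : Drawing V Ed) (Γ : GraphType Pr V Ed) (i : Ed × Plane) :
    (D.ends Γ i).Finite :=
  (Set.finite_singleton _).insert _

theorem IsQuasiDualTree.isArc_edge (hA : IsQuasiDualTree Γ A) (i : Ed × Plane) :
    IsArc (A.edge i) (i.2 + A.pos (Γ.src i.1)) (i.2 + A.pos (Γ.tgt i.1)) :=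
  (hA.isArc i.1).vadd i.2

theorem IsQuasiDualTree.edge_subset_tileSupp (hA : IsQuasiDualTree Γ A) (i : Ed × Plane) :
    A.edge i ⊆ Pr.tileSupp (Γ.tile i) :=
  Set.vadd_set_mono fun _ hz => hA.subset_supp _ (Set.mem_biUnion rfl hz)

/-- A vertex lying on an edge is an end point of this edge. -/
theorem IsQuasiDualTree.vertex_mem_arc (hA : IsQuasiDualTree Γ A) {w : V} {e : Ed}
    (hw : Γ.vertexHome w = Γ.home e) (h : A.pos w ∈ A.arc e) :
    A.pos w = A.pos (Γ.src e) ∨ A.pos w = A.pos (Γ.tgt e) := by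
  obtain ⟨e', he'⟩ := hA.exists_edge w
  by_cases hee : e = e'
  · subst hee
    exact he'.imp (congrArg _) (congrArg _)
  · have hhome : Γ.home e = Γ.home e' := by
      rcases he' with rfl | rfl
      · rw [← hw, Γ.src_home]
      · rw [← hw, Γ.tgt_home]
    have hmem : A.pos w ∈ A.arc e' := by
      rcases he' with rfl | rfl
      · exact (hA.isArc e').left_mem
      · exact (hA.isArc e').right_mem
    exact (hA.nonoverlapping e e' hhome hee ⟨h, hmem⟩).1

/-- Within one tile this is part of being a geometric graph. In different tiles a common point lies
on the frontier of the tile of `i`, where the graph has only boundary vertices, and a vertex on an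
edge is one of its ends. -/
theorem IsQuasiDualTree.edge_inter_edge (hA : IsQuasiDualTree Γ A) {i j : Ed × Plane}
    (hi : Γ.tile i ∈ σ.tiling p) (hj : Γ.tile j ∈ σ.tiling p) (hij : i ≠ j) :
    A.edge i ∩ A.edge j ⊆ A.ends Γ i := by
  rintro z ⟨hzi, hzj⟩
  obtain ⟨e, x⟩ := i
  obtain ⟨f, y⟩ := j
  by_cases ht : Γ.tile (e, x) = Γ.tile (f, y)
  · obtain ⟨hhome, rfl⟩ := Prod.mk.inj ht
    have hef : e ≠ f := fun h => hij (h ▸ rfl)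
    obtain ⟨a, ha, rfl⟩ := hzi
    obtain ⟨b, hb, hab⟩ := hzj
    obtain rfl : b = a := add_left_cancel hab
    exact (hA.nonoverlapping e f hhome hef ⟨ha, hb⟩).1.imp (congrArg (x + ·)) (congrArg (x + ·))
  · have hz := σ.inter_tileSupp_subset_frontier hi hj ht
      ⟨hA.edge_subset_tileSupp _ hzi, hA.edge_subset_tileSupp _ hzj⟩
    obtain ⟨a, ha, rfl⟩ := hzi
    have hfr : frontier (Pr.tileSupp (Γ.tile (e, x))) = x +ᵥ frontier (Pr.supp (Γ.home e)) :=
      ((Homeomorph.addLeft x).image_frontier _).symm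
    rw [hfr] at hz
    obtain ⟨b, hb, hab⟩ := hz
    obtain rfl : b = a := add_left_cancel hab
    have hbs : b ∈ A.carrier Γ (Γ.home e) ∩ frontier (Pr.supp (Γ.home e)) :=
      ⟨Set.mem_biUnion rfl ha, hb⟩
    rw [hA.inter_frontier] at hbs
    obtain ⟨s, hs, rfl⟩ := hbs
    exact (hA.vertex_mem_arc ((Γ.bdry_home s).trans hs) ha).imp
      (congrArg (x + ·)) (congrArg (x + ·))

/-- The puncture is interior to its tile, so no other tile reaches it, and in its own tile it is a
vertex. -/
theorem IsQuasiDualTree.puncture_mem_edge (hA : IsQuasiDualTree Γ A) {t : Tile P}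
    {i : Ed × Plane} (ht : t ∈ σ.tiling p) (hi : Γ.tile i ∈ σ.tiling p)
    (h : puncture t ∈ A.edge i) : puncture t ∈ A.ends Γ i := by
  by_cases hti : t = Γ.tile i
  · subst hti
    obtain ⟨e, x⟩ := i
    obtain ⟨a, ha, hax⟩ := h
    obtain rfl : a = 0 := by simpa [puncture, GraphType.tile] using hax
    rw [← hA.pos_center (Γ.home e)] at ha
    exact (hA.vertex_mem_arc (Γ.center_home _) ha).imp
      (fun h => by rw [← h, hA.pos_center]; simp [puncture, GraphType.tile])
      (fun h => by rw [← h, hA.pos_center]; simp [puncture, GraphType.tile])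
  · exact absurd (hA.edge_subset_tileSupp i h) (Set.disjoint_left.1
      (σ.disjoint_interior_tileSupp ht hi hti) (Pr.puncture_mem_interior t))

theorem GraphType.finite_edges_patch [Finite Ed] (Γ : GraphType Pr V Ed) (σ : Substitution Pr)
    (n : ℕ) (p : P) : {i : Ed × Plane | Γ.tile i ∈ σ.patch n p}.Finite :=
  (Set.finite_univ.prod ((σ.finite_patch n p).image Prod.snd)).subset
    fun i hi => ⟨trivial, Γ.tile i, hi, rfl⟩

/-- An arc in a union of edges of the tiling, with end points at punctures, contains every edge
of which it contains an interior point. -/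
theorem IsQuasiDualTree.edge_subset_arc [Finite Ed] (hA : IsQuasiDualTree Γ A) {γ : Set Plane}
    {t t' : Tile P} (ht : t ∈ σ.tiling p) (ht' : t' ∈ σ.tiling p)
    (hγ : IsArc γ (puncture t) (puncture t'))
    (hsub : ∀ z ∈ γ, ∃ i, Γ.tile i ∈ σ.tiling p ∧ z ∈ A.edge i) {i : Ed × Plane}
    (hi : Γ.tile i ∈ σ.tiling p) {z : Plane} (hz : z ∈ A.edge i) (hzi : z ∉ A.ends Γ i)
    (hzγ : z ∈ γ) : A.edge i ⊆ γ := by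
  obtain ⟨n, hn⟩ := σ.exists_subset_interior_patch p hγ.isCompact
  -- Every edge meeting `γ` belongs to this patch, so the finite union of the others is a closed set
  -- that can serve as `K`.
  let J : Set (Ed × Plane) := {j | Γ.tile j ∈ σ.patch n p} \ {i}
  have hJ : J.Finite := (Γ.finite_edges_patch σ n p).subset Set.sdiff_subset
  have hJt {j} (hj : j ∈ J) : Γ.tile j ∈ σ.tiling p := σ.patch_subset_tiling n p hj.1
  refine (hA.isArc_edge i).subset_of_mem (K := ⋃ j ∈ J, A.edge j)
    (hJ.isClosed_biUnion fun j _ => (hA.isArc_edge j).isCompact.isClosed) ?_ hγ ?_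
    (hA.puncture_mem_edge ht hi) (hA.puncture_mem_edge ht' hi) hz (fun h => hzi (.inl h))
    (fun h => hzi (.inr h)) hzγ
  · rintro w ⟨hw, hwJ⟩
    obtain ⟨j, hj, hwj⟩ := Set.mem_iUnion₂.1 hwJ
    exact hA.edge_inter_edge hi (hJt hj) (fun e => hj.2 e.symm) ⟨hw, hwj⟩
  · intro w hw
    obtain ⟨j, hj, hwj⟩ := hsub w hw
    by_cases hji : j = i
    · exact .inl (hji ▸ hwj)
    · exact .inr (Set.mem_biUnion ⟨σ.mem_patch_of_meets hj
        ⟨w, hn hw, hA.edge_subset_tileSupp j hwj⟩, hji⟩ hwj)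

/-- Ensures that the `finsum` giving the length of a path is a genuine finite sum, which can be
rearranged. -/
theorem IsQuasiDualTree.finite_edges_subset [Finite Ed] (hA : IsQuasiDualTree Γ A)
    {γ : Set Plane} (hγ : IsCompact γ) :
    {i : Ed × Plane | Γ.tile i ∈ σ.tiling p ∧ A.edge i ⊆ γ}.Finite := by
  obtain ⟨n, hn⟩ := σ.exists_subset_interior_patch p hγ
  refine (Γ.finite_edges_patch σ n p).subset fun i hi => ?_
  have hmem := (hA.isArc_edge i).left_mem
  exact σ.mem_patch_of_meets hi.1 ⟨_, hn (hi.2 hmem), hA.edge_subset_tileSupp i hmem⟩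

/-! ### Subdivision of the edges -/

/-- The edges into which the inflated edge `λ (A_e + x)` is divided. -/
def subdivision (σ : Substitution Pr) (Γ : GraphType Pr V Ed) (G S : Drawing V Ed)
    (i : Ed × Plane) : Set (Ed × Plane) :=
  ⋃ f, (fun x => (f, x + σ.scale • i.2)) '' edgeDigits σ Γ G S i.1 f

theorem mem_subdivision {i j : Ed × Plane} : j ∈ subdivision σ Γ G S i ↔
    ∃ x ∈ edgeDigits σ Γ G S i.1 j.1, j.2 = x + σ.scale • i.2 := by
  simp only [subdivision, Set.mem_iUnion, Set.mem_image]
  constructor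
  · rintro ⟨f, x, hx, rfl⟩
    exact ⟨x, hx, rfl⟩
  · rintro ⟨x, hx, e⟩
    exact ⟨j.1, x, hx, Prod.ext rfl e.symm⟩

theorem tile_mem_patch_succ_of_mem_subdivision {i j : Ed × Plane} {n : ℕ} (hi : Γ.tile i ∈ σ.patch n p)
    (hj : j ∈ subdivision σ Γ G S i) : Γ.tile j ∈ σ.patch (n + 1) p := by
  obtain ⟨x, hx, e⟩ := mem_subdivision.1 hj
  rw [σ.patch_succ]
  exact ⟨_, hi, _, hx.1, Prod.ext rfl e⟩

theorem tile_mem_tiling_of_mem_subdivision {i j : Ed × Plane} (hi : Γ.tile i ∈ σ.tiling p)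
    (hj : j ∈ subdivision σ Γ G S i) : Γ.tile j ∈ σ.tiling p := by
  obtain ⟨n, hn⟩ := σ.mem_tiling.1 hi
  exact σ.patch_subset_tiling _ p (tile_mem_patch_succ_of_mem_subdivision hn hj)

theorem finite_edgeDigits (e f : Ed) : (edgeDigits σ Γ G S e f).Finite :=
  (((σ.rule (Γ.home e)).finite_toSet).image Prod.snd).subset fun _ hx => ⟨_, hx.1, rfl⟩

theorem IsFractalGraph.smul_edge (hA : IsFractalGraph σ Γ G S A) (i : Ed × Plane) :
    σ.scale • A.edge i = ⋃ j ∈ subdivision σ Γ G S i, A.edge j := by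
  ext z
  rw [Drawing.edge, hA.attractor]
  simp only [Set.mem_iUnion, exists_prop, mem_subdivision]
  constructor
  · rintro ⟨_, ⟨y, hy, rfl⟩, rfl⟩
    simp only [Set.mem_iUnion, exists_prop] at hy
    obtain ⟨f, x, hx, _, ⟨w, hw, rfl⟩, rfl⟩ := hy
    refine ⟨(f, x + σ.scale • i.2), ⟨x, hx, rfl⟩, w, hw, ?_⟩
    simp only [vadd_eq_add, smul_add, smul_inv_smul₀ σ.scale_ne_zero]
    abel
  · rintro ⟨j, ⟨x, hx, e⟩, w, hw, rfl⟩
    refine ⟨i.2 +ᵥ σ.scale⁻¹ • (x +ᵥ w), ⟨_, ?_, rfl⟩, ?_⟩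
    · simp only [Set.mem_iUnion, exists_prop]
      exact ⟨j.1, x, hx, _, ⟨w, hw, rfl⟩, rfl⟩
    · simp only [vadd_eq_add, smul_add, smul_inv_smul₀ σ.scale_ne_zero, e]
      abel

/-! ### The fractal tree -/

/-- Points of `ℛ(F_n)` are handled by translating edges from a subtile. Points of the old `F_n` are
now inflated once more, and the attractor equation resolves the inflated edge into edges of the next
patch. -/
theorem IsFractalGraph.stage_subset (hA : IsFractalGraph σ Γ G S A) (hE : IsSeed σ Γ G S A E₁)
    (n : ℕ) (p : P) : ∀ z ∈ stage σ (seedCarrier σ A E₁) n p,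
      ∃ i, Γ.tile i ∈ σ.patch (n + 1) p ∧ σ.scale ^ (n + 1) • z ∈ A.edge i := by
  induction n generalizing p with
  | zero =>
    intro z hz
    simp only [stage, seedCarrier, Set.mem_iUnion, exists_prop] at hz
    obtain ⟨i, hi, w, hw, rfl⟩ := hz
    refine ⟨i, σ.mem_patch_succ_iff.2 ⟨_, hE.subgraph p i hi, (Γ.home i.1, 0), rfl, ?_⟩, ?_⟩
    · simp [GraphType.tile]
    · rw [zero_add, pow_one]
      exact (smul_inv_smul₀ σ.scale_ne_zero w).symm ▸ hw
  | succ n ih =>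
    rintro z (hz | hz)
    · simp only [Substitution.contraction, Set.mem_iUnion, exists_prop] at hz
      obtain ⟨t, ht, _, ⟨w, hw, rfl⟩, rfl⟩ := hz
      obtain ⟨i, hi, y, hy, e⟩ := ih t.1 w hw
      refine ⟨(i.1, i.2 + σ.scale ^ (n + 1) • t.2),
        σ.mem_patch_succ_iff.2 ⟨t, ht, _, hi, rfl⟩, y, hy, ?_⟩
      simp only [vadd_eq_add] at e ⊢
      rw [pow_succ _ (n + 1), mul_smul _ σ.scale, smul_inv_smul₀ σ.scale_ne_zero, smul_add, ← e]
      abel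
    · obtain ⟨i, hi, hy⟩ := ih p z hz
      have : σ.scale ^ (n + 1 + 1) • z ∈ σ.scale • A.edge i := by
        rw [pow_succ', mul_smul]
        exact ⟨_, hy, rfl⟩
      rw [hA.smul_edge] at this
      obtain ⟨j, hj, hz⟩ := Set.mem_iUnion₂.1 this
      exact ⟨j, tile_mem_patch_succ_of_mem_subdivision hi hj, hz⟩

theorem IsFractalGraph.fractalTree_subset (hA : IsFractalGraph σ Γ G S A)
    (hE : IsSeed σ Γ G S A E₁) {z : Plane} (hz : z ∈ fractalTree σ A E₁ p) :
    ∃ i, Γ.tile i ∈ σ.tiling p ∧ z ∈ A.edge i := by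
  obtain ⟨n, w, hw, rfl⟩ := Set.mem_iUnion.1 hz
  obtain ⟨i, hi, h⟩ := hA.stage_subset hE n p w hw
  exact ⟨i, σ.patch_subset_tiling _ p hi, h⟩

theorem smul_fractalTree_subset :
    σ.scale • fractalTree σ A E₁ p ⊆ fractalTree σ A E₁ p := by
  rintro _ ⟨z, hz, rfl⟩
  obtain ⟨n, w, hw, rfl⟩ := Set.mem_iUnion.1 hz
  exact Set.mem_iUnion.2 ⟨n + 1, w, .inr hw, by simp only [smul_smul, ← pow_succ']⟩

theorem IsFractalGraph.puncture_mem_stage (hA : IsFractalGraph σ Γ G S A)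
    (hE : IsSeed σ Γ G S A E₁) (n : ℕ) (p : P) : ∀ t ∈ σ.patch (n + 1) p,
      puncture t ∈ σ.scale ^ (n + 1) • stage σ (seedCarrier σ A E₁) n p := by
  induction n generalizing p with
  | zero =>
    intro t ht
    obtain ⟨t, hr, _, rfl, rfl⟩ := σ.mem_patch_succ_iff.1 ht
    obtain ⟨i, hi, h⟩ := hE.puncture_mem p t hr
    refine ⟨σ.scale⁻¹ • puncture t, ?_, ?_⟩
    · refine Set.mem_biUnion hi ?_
      rcases h with h | h
      · exact h ▸ ⟨_, (hA.quasiDual.isArc_edge i).left_mem, rfl⟩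
      · exact h ▸ ⟨_, (hA.quasiDual.isArc_edge i).right_mem, rfl⟩
    · simp [puncture, smul_inv_smul₀ σ.scale_ne_zero]
  | succ n ih =>
    intro t ht
    obtain ⟨t, hr, s, hs, rfl⟩ := σ.mem_patch_succ_iff.1 ht
    obtain ⟨w, hw, e⟩ := ih t.1 s hs
    refine ⟨σ.scale⁻¹ • (t.2 +ᵥ w), .inl (Set.mem_biUnion hr ⟨_, ⟨w, hw, rfl⟩, rfl⟩), ?_⟩
    simp only [puncture, vadd_eq_add] at e ⊢
    rw [pow_succ _ (n + 1), mul_smul _ σ.scale, smul_inv_smul₀ σ.scale_ne_zero, smul_add, e,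
      add_comm]

theorem IsFractalGraph.puncture_mem_fractalTree (hA : IsFractalGraph σ Γ G S A)
    (hE : IsSeed σ Γ G S A E₁) {t : Tile P} (ht : t ∈ σ.tiling p) :
    puncture t ∈ fractalTree σ A E₁ p := by
  obtain ⟨n, hn⟩ := σ.mem_tiling.1 ht
  -- Stage `n` stands for `F_{n+1}` and goes with `ω^{n+1}(p)`, hence the passage to the next patch.
  exact Set.mem_iUnion.2 ⟨n, hA.puncture_mem_stage hE n p t (σ.patch_subset_succ n p hn)⟩

/-! ### Lengths -/

theorem finite_subdivision [Finite Ed] (i : Ed × Plane) : (subdivision σ Γ G S i).Finite :=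
  Set.finite_iUnion fun _ => (finite_edgeDigits _ _).image _

theorem IsPerronFrobenius.sum_subdivision [Fintype Ed]
    (hκ : IsPerronFrobenius (edgeMatrix σ Γ G S) κ v) (i : Ed × Plane) :
    ∑ᶠ j ∈ subdivision σ Γ G S i, v j.1 = κ * v i.1 := by
  have h := congrFun hκ.2 i.1
  rw [Pi.smul_apply, smul_eq_mul] at h
  rw [← h, subdivision, finsum_mem_iUnion _ fun _ => (finite_edgeDigits _ _).image _,
    finsum_eq_sum_of_fintype, Matrix.mulVec, dotProduct]
  · refine Finset.sum_congr rfl fun f _ => ?_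
    -- The summand depends only on the label `f`, so each inner sum is the number of digits times `v
    -- f`.
    rw [finsum_mem_image fun x _ y _ h => add_right_cancel (Prod.mk.inj h).2,
      finsum_mem_eq_finite_toFinset_sum _ (finite_edgeDigits _ _)]
    refine (Finset.sum_const (v f)).trans ?_
    rw [nsmul_eq_mul, ← Set.ncard_eq_toFinset_card _ (finite_edgeDigits _ _)]
    rfl
  · intro f g hfg
    refine Set.disjoint_left.2 ?_
    rintro _ ⟨x, -, rfl⟩ ⟨y, -, h⟩
    exact hfg (Prod.mk.inj h).1.symm

/-- A common piece would lie in the inflated intersection of two distinct edges, which is finite,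
whereas an arc is infinite. -/
theorem IsFractalGraph.disjoint_subdivision (hA : IsFractalGraph σ Γ G S A)
    {i j : Ed × Plane} (hi : Γ.tile i ∈ σ.tiling p) (hj : Γ.tile j ∈ σ.tiling p) (hij : i ≠ j) :
    Disjoint (subdivision σ Γ G S i) (subdivision σ Γ G S j) := by
  refine Set.disjoint_left.2 fun k hki hkj => ?_
  have hsub {l : Ed × Plane} (hk : k ∈ subdivision σ Γ G S l) :
      A.edge k ⊆ σ.scale • A.edge l := by
    rw [hA.smul_edge]
    exact Set.subset_biUnion_of_mem hk
  refine (hA.quasiDual.isArc_edge k).infinite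
    (((A.finite_ends Γ i).image (σ.scale • ·)).subset fun z hz => ?_)
  obtain ⟨a, ha, rfl⟩ := hsub hki hz
  obtain ⟨b, hb, hab⟩ := hsub hkj hz
  obtain rfl : b = a := smul_right_injective Plane σ.scale_ne_zero hab
  exact ⟨b, hA.quasiDual.edge_inter_edge hi hj hij ⟨ha, hb⟩, rfl⟩

/-- The edges making up the inflation `λ γ` of a path `γ` between punctures are those into which
the inflated edges of `γ` are divided. -/
theorem IsFractalGraph.edges_smul_arc [Finite Ed] (hA : IsFractalGraph σ Γ G S A)
    {γ : Set Plane} {t t' : Tile P} (ht : t ∈ σ.tiling p) (ht' : t' ∈ σ.tiling p)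
    (hγ : IsArc γ (puncture t) (puncture t'))
    (hsub : ∀ z ∈ γ, ∃ i, Γ.tile i ∈ σ.tiling p ∧ z ∈ A.edge i) :
    {j : Ed × Plane | Γ.tile j ∈ σ.tiling p ∧ A.edge j ⊆ σ.scale • γ} =
      ⋃ i ∈ {i : Ed × Plane | Γ.tile i ∈ σ.tiling p ∧ A.edge i ⊆ γ},
        subdivision σ Γ G S i := by
  ext j
  simp only [Set.mem_iUnion, exists_prop]
  constructor
  · rintro ⟨hj, hjγ⟩
    obtain ⟨n, hn⟩ := σ.exists_subset_interior_patch p hγ.isCompact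
    -- A generic point `z` of the edge `j` avoids these finitely many points. Avoiding the inflated
    -- ends forces `γ` to contain the whole edge `i` through `λ⁻¹ z`; avoiding the ends of `j`
    -- forces the piece of `λ A_i` through `z` to be `j`.
    have hfin : (A.ends Γ j ∪ ⋃ i ∈ {i : Ed × Plane | Γ.tile i ∈ σ.patch n p},
        (σ.scale • ·) '' A.ends Γ i).Finite :=
      (A.finite_ends Γ j).union
        ((Γ.finite_edges_patch σ n p).biUnion fun i _ => (A.finite_ends Γ i).image _)
    obtain ⟨z, hzj, hz⟩ := ((hA.quasiDual.isArc_edge j).infinite.sdiff hfin).nonempty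
    obtain ⟨w, hw, rfl⟩ := hjγ hzj
    obtain ⟨i, hi, hwi⟩ := hsub w hw
    have hip : Γ.tile i ∈ σ.patch n p := σ.mem_patch_of_meets hi
      ⟨w, hn hw, hA.quasiDual.edge_subset_tileSupp i hwi⟩
    have hwe : w ∉ A.ends Γ i := fun h => hz (.inr (Set.mem_biUnion hip ⟨w, h, rfl⟩))
    refine ⟨i, ⟨hi, hA.quasiDual.edge_subset_arc ht ht' hγ hsub hi hwi hwe hw⟩, ?_⟩
    have hwi' : σ.scale • w ∈ σ.scale • A.edge i := ⟨w, hwi, rfl⟩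
    rw [hA.smul_edge] at hwi'
    obtain ⟨k, hk, hwk⟩ := Set.mem_iUnion₂.1 hwi'
    by_cases hjk : j = k
    · exact hjk ▸ hk
    · exact absurd (hA.quasiDual.edge_inter_edge hj
        (tile_mem_tiling_of_mem_subdivision hi hk) hjk ⟨hzj, hwk⟩) fun h => hz (.inl h)
  · rintro ⟨i, ⟨hi, hiγ⟩, hj⟩
    refine ⟨tile_mem_tiling_of_mem_subdivision hi hj, ?_⟩
    refine Set.Subset.trans ?_ (Set.smul_set_mono hiγ)
    rw [hA.smul_edge]
    exact Set.subset_biUnion_of_mem hj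

theorem IsFractalGraph.sum_edges_smul_arc [Fintype Ed] (hA : IsFractalGraph σ Γ G S A)
    (hκ : IsPerronFrobenius (edgeMatrix σ Γ G S) κ v) {γ : Set Plane} {t t' : Tile P}
    (ht : t ∈ σ.tiling p) (ht' : t' ∈ σ.tiling p) (hγ : IsArc γ (puncture t) (puncture t'))
    (hsub : ∀ z ∈ γ, ∃ i, Γ.tile i ∈ σ.tiling p ∧ z ∈ A.edge i) :
    ∑ᶠ j ∈ {j : Ed × Plane | Γ.tile j ∈ σ.tiling p ∧ A.edge j ⊆ σ.scale • γ}, v j.1 =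
      κ * ∑ᶠ i ∈ {i : Ed × Plane | Γ.tile i ∈ σ.tiling p ∧ A.edge i ⊆ γ}, v i.1 := by
  have hfin := hA.quasiDual.finite_edges_subset (σ := σ) (p := p) hγ.isCompact
  rw [hA.edges_smul_arc ht ht' hγ hsub, finsum_mem_biUnion
    (fun i hi j hj hij => hA.disjoint_subdivision hi.1 hj.1 hij) hfin
    (fun i _ => finite_subdivision i)]
  exact (finsum_mem_congr rfl fun i _ => hκ.sum_subdivision i).trans
    (mul_finsum_mem' (fun i : Ed × Plane => v i.1) κ hfin).symm

/-- No arc has equal end points, so the path is empty and contains no edge. -/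
theorem IsFractalGraph.fractalDist_eq_zero (hA : IsFractalGraph σ Γ G S A) {t t' : Tile P}
    (h : puncture t = puncture t') : fractalDist σ Γ A v E₁ p t t' = 0 := by
  rw [fractalDist, h, treePath_self]
  refine finsum_mem_eq_zero_of_forall_eq_zero fun i hi => ?_
  exact absurd (hi.2 (hA.quasiDual.isArc_edge i).left_mem) (Set.notMem_empty _)

end Edges

end FractalTiling

theorem mainTheorem5 {P Side V Ed : Type*} [Fintype P] [DecidableEq P] [Finite Side]
    [Fintype Ed] [DecidableEq Ed]
    (Pr : PrototileSet P Side) (σ : Substitution Pr) (hσ : σ.IsPrimitive)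
    (Γ : GraphType Pr V Ed) (G S A : Drawing V Ed)
    (hGS : IsRecurrentPair σ Γ G S) (hA : IsFractalGraph σ Γ G S A)
    (hM : (edgeMatrix σ Γ G S).IsPrimitive)
    (κ : ℝ) (v : Ed → ℝ) (hκ : IsPerronFrobenius (edgeMatrix σ Γ G S) κ v)
    (E₁ : P → Set (Ed × Plane)) (p : P) (hF : IsFractalTree σ Γ G S A E₁ p)
    (t t' r r' : Tile P) (ht : t ∈ σ.tiling p) (ht' : t' ∈ σ.tiling p)
    (hr : r = σ.root t) (hr' : r' = σ.root t') :
    fractalDist σ Γ A v E₁ p r r' = κ * fractalDist σ Γ A v E₁ p t t' := by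
  subst hr hr'
  by_cases hpt : puncture t = puncture t'
  · rw [hA.fractalDist_eq_zero hpt, mul_zero]
    exact hA.fractalDist_eq_zero (congrArg (σ.scale • ·) hpt)
  · obtain ⟨γ, ⟨hγF, hγ⟩, -⟩ := hF.2.2 _ (hA.puncture_mem_fractalTree hF.1 ht) _
      (hA.puncture_mem_fractalTree hF.1 ht') hpt
    have h1 := treePath_eq hF.2 hγF hγ
    -- The punctures of the roots are `λ x(t)` and `λ x(t')` by definition, so `λγ` is an arc
    -- between them inside the tree.
    have h2 : treePath (fractalTree σ A E₁ p) (puncture (σ.root t)) (puncture (σ.root t')) =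
        σ.scale • γ := treePath_eq hF.2
      ((Set.smul_set_mono hγF).trans smul_fractalTree_subset) (hγ.smul σ.scale_ne_zero)
    rw [fractalDist, fractalDist, h1, h2]
    exact hA.sum_edges_smul_arc hκ ht ht' hγ fun z hz => hA.fractalTree_subset hF.1 (hγF hz)
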